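/- Let $d\geq 1$, $V_n=\mathbb Z^d\cap[1,n]^d$ ($n\ge 1$), and let $(g_x)_{x\in\mathbb Z^d}$ be independent real random variables with mean zero and variance one. Let $\beta>0$, $\mu>0$, and let $(h_n)_{n\ge1}$ be a real sequence with $\mu-h_n>0$ such that, for every $\varepsilon>0$, $$h_n\to\mu,\qquad (\mu-h_n)\sqrt{|V_n|}\to\infty,\qquad \frac1{|V_n|}\sum_{x\in V_n}\mathbb E\big(|g_x|^3\,\mathbf 1\{|g_x|\ge\varepsilon(\mu-h_n)^{-1}\}\big)\to0\qquad(n\to\infty).$$ For $b>0$ and $m\in\mathbb R$ let $$Z_n(b,m)=\sum_{\sigma\in\{\pm1\}^{V_n}}\exp\Big(b\sum_{\langle xy\rangle}\sigma_x\sigma_y+(m-h_n)\sum_{x\in V_n}g_x\sigma_x\Big),$$ where $\langle xy\rangle$ runs over the ordered pairs of nearest neighbours in $V_n$, and let $p(b,m)=\limsup_{n}|V_n|^{-1}\,\mathbb E\log Z_n(b,m)$ (the limit, whenever it exists). Let $\mathcal A$ be the set of all $(b,m)\in(0,\infty)^2$ at which the left and right derivatives of $p$ with respect to its second argument differ. Let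 $\langle\cdot\rangle$ be the expectation with respect to the random Gibbs measure on $\{\pm1\}^{V_n}$ whose density is proportional to the exponential above with $(b,m)=(\beta,\mu)$, and put $\nu(f)=\mathbb E\langle f\rangle$ and $\Delta_n=|V_n|^{-1}\sum_{x\in V_n}g_x\sigma_x$. Then, for each $b>0$, the set $\{m:(b,m)\in\mathcal A\}$ is countable; and if $(\beta,\mu)\notin\mathcal A$, then $$\nu\big(|\Delta_n-\nu(\Delta_n)|\big)\longrightarrow0\qquad(n\to\infty).$$ -/

import Mathlib

open MeasureTheory ProbabilityTheory Filter Topology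
open scoped ENNReal

noncomputable section

namespace RFIM

/-- The box `V_n = ℤ^d ∩ [1,n]^d`. -/
def box (d n : ℕ) : Finset (Fin d → ℤ) :=
  Fintype.piFinset fun _ => Finset.Icc 1 (n : ℤ)

/-- Spin configurations on `V_n`; the spins lie in `ℤˣ = {1, -1}`. -/
abbrev Config (d n : ℕ) : Type := box d n → ℤˣ

/-- The spin at a site, as a real number `±1`. -/
def spin {d n : ℕ} (σ : Config d n) (x : box d n) : ℝ := ((σ x : ℤ) : ℝ)

/-- Nearest neighbours of the hypercubic lattice: `ℓ¹`-distance one. -/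
def Neighbor {d : ℕ} (x y : Fin d → ℤ) : Prop := ∑ i, |x i - y i| = 1

open Classical in
/-- The ordered pairs of nearest neighbours in `V_n`. -/
def neighborPairs (d n : ℕ) : Finset (box d n × box d n) :=
  Finset.univ.filter fun e => Neighbor e.1.1 e.2.1

/-- `β ∑_{⟨xy⟩} σ_x σ_y + s ∑_x u_x σ_x`, for the realization `u` of the disorder and
the field strength `s`. -/
def energy {d n : ℕ} (β s : ℝ) (u : box d n → ℝ) (σ : Config d n) : ℝ :=
  β * (∑ e ∈ neighborPairs d n, spin σ e.1 * spin σ e.2) + s * (∑ x, u x * spin σ x)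

/-- The partition function `Z_n`. -/
def partitionFn {d n : ℕ} (β s : ℝ) (u : box d n → ℝ) : ℝ :=
  ∑ σ : Config d n, Real.exp (energy β s u σ)

/-- The Gibbs weight `G({σ})`. -/
def gibbsWeight {d n : ℕ} (β s : ℝ) (u : box d n → ℝ) (σ : Config d n) : ℝ :=
  Real.exp (energy β s u σ) / partitionFn β s u

/-- The Gibbs expectation `⟨f⟩` for the realization `u` of the disorder. -/
def gibbsExp {d n : ℕ} (β s : ℝ) (u : box d n → ℝ) (f : Config d n → ℝ) : ℝ :=
  ∑ σ : Config d n, f σ * gibbsWeight β s u σ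

/-- The part of the energy density due to the disorder: `|V_n|⁻¹ ∑_x u_x σ_x`. -/
def disorderEnergy {d n : ℕ} (u : box d n → ℝ) (σ : Config d n) : ℝ :=
  ((box d n).card : ℝ)⁻¹ * ∑ x, u x * spin σ x

section Random

variable {Ω : Type*} [MeasurableSpace Ω] {d : ℕ}

/-- The disorder in the box `V_n` at the sample point `ω`. -/
def field (g : (Fin d → ℤ) → Ω → ℝ) (n : ℕ) (ω : Ω) : box d n → ℝ := fun x => g x ω

/-- `ν(f) = 𝔼⟨f⟩`, for an observable `f` of the disorder in `V_n` and of the spins. -/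
def nu (P : Measure Ω) (g : (Fin d → ℤ) → Ω → ℝ) (n : ℕ) (β s : ℝ)
    (f : (box d n → ℝ) → Config d n → ℝ) : ℝ :=
  ∫ ω, gibbsExp β s (field g n ω) (f (field g n ω)) ∂P

/-- The expected free-energy density `p_n(β, μ) = |V_n|⁻¹ 𝔼 log Z_n`, where `Z_n` has field
strength `μ - h_n`. -/
def freeEnergy (P : Measure Ω) (g : (Fin d → ℤ) → Ω → ℝ) (h : ℕ → ℝ) (n : ℕ) (β μ : ℝ) : ℝ :=
  ∫ ω, Real.log (partitionFn β (μ - h n) (field g n ω)) / ((box d n).card : ℝ) ∂P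

/-- The limiting free energy `p(β, μ)`. The upper limit is used, which is the limit of
`p_n(β, μ)` whenever that limit exists; `h` is the same sequence for all arguments `μ`. -/
def limitFreeEnergy (P : Measure Ω) (g : (Fin d → ℤ) → Ω → ℝ) (h : ℕ → ℝ) (β μ : ℝ) : ℝ :=
  limsup (fun n => freeEnergy P g h n β μ) atTop

/-- The set `𝒜` of the points `(β, μ)` of `(0,∞)²` at which the left and the right derivative
of the limiting free energy with respect to `μ` differ. (For bounded `h` and integrable disorder
of bounded mean absolute value the limiting free energy is finite and convex in `μ`, so that both
one-sided derivatives exist.) -/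
def singularSet (P : Measure Ω) (g : (Fin d → ℤ) → Ω → ℝ) (h : ℕ → ℝ) : Set (ℝ × ℝ) :=
  {q | 0 < q.1 ∧ 0 < q.2 ∧
    derivWithin (limitFreeEnergy P g h q.1) (Set.Iio q.2) q.2 ≠
      derivWithin (limitFreeEnergy P g h q.1) (Set.Ioi q.2) q.2}

/-- `|V_n|⁻¹ ∑_{x ∈ V_n} 𝔼(|g_x|³ : |g_x| ≥ K)`, with values in `[0,∞]`. -/
def thirdMomentTail (P : Measure Ω) (g : (Fin d → ℤ) → Ω → ℝ) (n : ℕ) (K : ℝ) : ℝ≥0∞ :=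
  (∑ x ∈ box d n, ∫⁻ ω in {ω | K ≤ |g x ω|}, ENNReal.ofReal (|g x ω| ^ 3) ∂P) /
    ((box d n).card : ℝ≥0∞)

end Random

end RFIM

end

/-!
Write `s = μ - h_n`, which tends to zero, and `Δ = |V_n|⁻¹ ∑_x g_x σ_x`.

*Concentration.* It suffices that `ν(Δ²) → 0`, since `ν|Δ - ν(Δ)| ≤ 2 ν|Δ| ≤ 2 √(ν(Δ²))`
(`RFIM.nu_abs_disorderEnergy_sub_le`). Expanding the square gives
`ν(Δ²) = |V_n|⁻² ∑_{x,y} 𝔼(g_x g_y ⟨σ_x σ_y⟩)`. The diagonal contributes `|V_n|⁻¹`, because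
`𝔼 g_x² = 1`. For `x ≠ y` regard `⟨σ_x σ_y⟩` as a function of `(g_x, g_y)`: since `g_x` and `g_y`
are centred and independent of each other and of the rest of the disorder, nothing changes on
replacing it by its mixed second difference between `(g_x, g_y)` and `(0, 0)`
(`RFIM.integral_mul_update_eq_zero`). A derivative of a Gibbs expectation in the disorder at one
site is `s` times a covariance of bounded observables, so this mixed difference is at most
`6 s² |g_x| |g_y|` (`RFIM.abs_gibbsExp_mixed_difference_le`), and each off-diagonal term is at
most `6 s²`. Hence `ν(Δ²) ≤ |V_n|⁻¹ + 6 s²` (`RFIM.nu_disorderEnergy_sq_le`). This is a discrete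
form of integrating by parts twice, for which two moments of the disorder suffice.

*Countability.* For fixed `b` the free energies `p_n(b, ·)` are convex, being averages of
logarithms of sums of exponentials of affine functions, and they are bounded in `n`. Their upper
limit is therefore a finite convex function (`RFIM.convexOn_limitFreeEnergy`). Its right
derivative is monotone, and its one-sided derivatives agree wherever the right derivative is
continuous, hence off a countable set (`ConvexOn.countable_leftDeriv_ne_rightDeriv`).
-/

namespace RFIM

/-! ### Gibbs expectations -/

section Gibbs

variable {d n : ℕ} (β s : ℝ) (u : box d n → ℝ)

lemma abs_spin (σ : Config d n) (x : box d n) : |spin σ x| = 1 := by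
  rcases Int.units_eq_one_or (σ x) with h | h <;> simp [spin, h]

lemma spin_mul_self (σ : Config d n) (x : box d n) : spin σ x * spin σ x = 1 := by
  rcases Int.units_eq_one_or (σ x) with h | h <;> simp [spin, h]

lemma partitionFn_pos : 0 < partitionFn β s u :=
  Finset.sum_pos (fun _ _ => Real.exp_pos _) Finset.univ_nonempty

lemma gibbsWeight_nonneg (σ : Config d n) : 0 ≤ gibbsWeight β s u σ :=
  div_nonneg (Real.exp_pos _).le (partitionFn_pos β s u).le

lemma sum_gibbsWeight : ∑ σ : Config d n, gibbsWeight β s u σ = 1 := by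
  unfold gibbsWeight
  rw [← Finset.sum_div]
  exact div_self (partitionFn_pos β s u).ne'

lemma gibbsExp_const (c : ℝ) : gibbsExp β s u (fun _ => c) = c := by
  rw [gibbsExp, ← Finset.mul_sum, sum_gibbsWeight, mul_one]

lemma gibbsExp_mono {f f' : Config d n → ℝ} (hff : ∀ σ, f σ ≤ f' σ) :
    gibbsExp β s u f ≤ gibbsExp β s u f' :=
  Finset.sum_le_sum fun σ _ => mul_le_mul_of_nonneg_right (hff σ) (gibbsWeight_nonneg β s u σ)

lemma gibbsExp_add (f f' : Config d n → ℝ) :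
    gibbsExp β s u (fun σ => f σ + f' σ) = gibbsExp β s u f + gibbsExp β s u f' := by
  simp only [gibbsExp, add_mul, Finset.sum_add_distrib]

lemma gibbsExp_const_mul (c : ℝ) (f : Config d n → ℝ) :
    gibbsExp β s u (fun σ => c * f σ) = c * gibbsExp β s u f := by
  simp only [gibbsExp, Finset.mul_sum, mul_assoc]

lemma gibbsExp_sum {ι : Type*} (t : Finset ι) (f : ι → Config d n → ℝ) :
    gibbsExp β s u (fun σ => ∑ i ∈ t, f i σ) = ∑ i ∈ t, gibbsExp β s u (f i) := by
  simp only [gibbsExp, Finset.sum_mul]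
  exact Finset.sum_comm

lemma abs_gibbsExp_le_of_abs_le {f : Config d n → ℝ} {C : ℝ} (hf : ∀ σ, |f σ| ≤ C) :
    |gibbsExp β s u f| ≤ C := by
  refine abs_le.2 ⟨?_, ?_⟩
  · rw [← gibbsExp_const β s u (-C)]
    exact gibbsExp_mono β s u fun σ => (abs_le.1 (hf σ)).1
  · rw [← gibbsExp_const β s u C]
    exact gibbsExp_mono β s u fun σ => (abs_le.1 (hf σ)).2

/-- The Gibbs expectation of `f`, written as a ratio of unnormalized sums. -/
lemma gibbsExp_eq_div (f : Config d n → ℝ) :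
    gibbsExp β s u f = (∑ σ, f σ * Real.exp (energy β s u σ)) / partitionFn β s u := by
  simp only [gibbsExp, gibbsWeight, Finset.sum_div, mul_div_assoc]

lemma continuous_energy (σ : Config d n) : Continuous fun u => energy β s u σ := by
  unfold energy
  fun_prop

lemma continuous_partitionFn : Continuous fun u : box d n → ℝ => partitionFn β s u :=
  continuous_finsetSum _ fun σ _ => Real.continuous_exp.comp (continuous_energy β s σ)

lemma continuous_gibbsExp {f : (box d n → ℝ) → Config d n → ℝ}
    (hf : ∀ σ, Continuous fun u => f u σ) : Continuous fun u => gibbsExp β s u (f u) :=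
  continuous_finsetSum _ fun σ _ => (hf σ).mul <|
    (Real.continuous_exp.comp (continuous_energy β s σ)).div (continuous_partitionFn β s)
      fun u => (partitionFn_pos β s u).ne'

/-- The energy is affine in the disorder at each single site. -/
lemma energy_update (x : box d n) (t : ℝ) (σ : Config d n) :
    energy β s (Function.update u x t) σ
      = energy β s (Function.update u x 0) σ + t * (s * spin σ x) := by
  have hz : ∀ z, Function.update u x t z
      = Function.update u x 0 z + if z = x then t else 0 := by
    intro z
    by_cases hzx : z = x
    · subst hzx; simp
    · simp [hzx]
  simp only [energy, hz, add_mul, ite_mul, zero_mul, Finset.sum_add_distrib,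
    Finset.sum_ite_eq', Finset.mem_univ, if_true]
  ring

/-- Differentiating a Gibbs expectation in the disorder at the site `x` gives `s` times the
covariance with the spin at `x`. -/
lemma hasDerivAt_gibbsExp_update (x : box d n) (f : Config d n → ℝ) (t : ℝ) :
    HasDerivAt (fun t => gibbsExp β s (Function.update u x t) f)
      (s * (gibbsExp β s (Function.update u x t) (fun σ => f σ * spin σ x)
        - gibbsExp β s (Function.update u x t) f
          * gibbsExp β s (Function.update u x t) (fun σ => spin σ x))) t := by
  have hE : ∀ σ : Config d n, HasDerivAt
      (fun t => Real.exp (energy β s (Function.update u x t) σ))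
      (Real.exp (energy β s (Function.update u x t) σ) * (s * spin σ x)) t := by
    intro σ
    refine HasDerivAt.exp ?_
    rw [funext fun t => energy_update β s u x t σ]
    simpa using ((hasDerivAt_id t).mul_const (s * spin σ x)).const_add
      (energy β s (Function.update u x 0) σ)
  have hN : HasDerivAt
      (fun t => ∑ σ, f σ * Real.exp (energy β s (Function.update u x t) σ))
      (∑ σ, f σ * (Real.exp (energy β s (Function.update u x t) σ) * (s * spin σ x))) t :=
    HasDerivAt.fun_sum fun σ _ => (hE σ).const_mul (f σ)
  have hZ : HasDerivAt (fun t => partitionFn β s (Function.update u x t))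
      (∑ σ, Real.exp (energy β s (Function.update u x t) σ) * (s * spin σ x)) t :=
    HasDerivAt.fun_sum fun σ _ => hE σ
  have hpos := (partitionFn_pos β s (Function.update u x t)).ne'
  simp only [gibbsExp_eq_div]
  refine (hN.div hZ hpos).congr_deriv ?_
  have h1 : ∑ σ, f σ * (Real.exp (energy β s (Function.update u x t) σ) * (s * spin σ x))
      = s * ∑ σ, f σ * spin σ x * Real.exp (energy β s (Function.update u x t) σ) := by
    rw [Finset.mul_sum]
    exact Finset.sum_congr rfl fun σ _ => by ring
  have h2 : ∑ σ, Real.exp (energy β s (Function.update u x t) σ) * (s * spin σ x)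
      = s * ∑ σ, spin σ x * Real.exp (energy β s (Function.update u x t) σ) := by
    rw [Finset.mul_sum]
    exact Finset.sum_congr rfl fun σ _ => by ring
  rw [h1, h2]
  field_simp

/-- A Gibbs expectation of an observable bounded by one is Lipschitz in the disorder at each
site. -/
lemma abs_gibbsExp_update_sub_le {f : Config d n → ℝ} (hf : ∀ σ, |f σ| ≤ 1) (x : box d n)
    (t t' : ℝ) :
    |gibbsExp β s (Function.update u x t) f - gibbsExp β s (Function.update u x t') f|
      ≤ 2 * |s| * |t - t'| := by
  refine convex_univ.norm_image_sub_le_of_norm_hasDerivWithin_le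
    (fun r _ => (hasDerivAt_gibbsExp_update β s u x f r).hasDerivWithinAt) (fun r _ => ?_)
    (Set.mem_univ t') (Set.mem_univ t)
  set v := Function.update u x r
  have h1 : |gibbsExp β s v (fun σ => f σ * spin σ x)| ≤ 1 :=
    abs_gibbsExp_le_of_abs_le β s v fun σ => by rw [abs_mul, abs_spin, mul_one]; exact hf σ
  have h2 : |gibbsExp β s v f| ≤ 1 := abs_gibbsExp_le_of_abs_le β s v hf
  have h3 : |gibbsExp β s v (fun σ => spin σ x)| ≤ 1 :=
    abs_gibbsExp_le_of_abs_le β s v fun σ => (abs_spin σ x).le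
  rw [Real.norm_eq_abs, abs_mul, mul_comm 2]
  refine mul_le_mul_of_nonneg_left ?_ (abs_nonneg s)
  have h4 : |gibbsExp β s v f * gibbsExp β s v (fun σ => spin σ x)| ≤ 1 := by
    rw [abs_mul]
    exact mul_le_one₀ h2 (abs_nonneg _) h3
  refine (abs_sub (gibbsExp β s v (fun σ => f σ * spin σ x)) _).trans ?_
  linarith

/-- The mixed second difference of `⟨σ_x σ_y⟩` in the disorder at two sites `x ≠ y`. Its
derivative in one variable is a difference of the two terms `⟨σ_y⟩ - ⟨σ_x σ_y⟩⟨σ_x⟩`, which are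
Lipschitz in the other variable. -/
lemma abs_gibbsExp_mixed_difference_le {x y : box d n} (hxy : x ≠ y) :
    |(gibbsExp β s u (fun σ => spin σ x * spin σ y)
        - gibbsExp β s (Function.update u y 0) (fun σ => spin σ x * spin σ y))
      - (gibbsExp β s (Function.update u x 0) (fun σ => spin σ x * spin σ y)
        - gibbsExp β s (Function.update (Function.update u y 0) x 0)
            (fun σ => spin σ x * spin σ y))| ≤ 6 * s ^ 2 * |u x| * |u y| := by
  set f : Config d n → ℝ := fun σ => spin σ x * spin σ y
  have hf : ∀ σ, |f σ| ≤ 1 := fun σ => by simp [f, abs_mul, abs_spin]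
  have hfx : (fun σ : Config d n => f σ * spin σ x) = fun σ => spin σ y := by
    funext σ
    simp only [f]
    linear_combination spin σ y * spin_mul_self σ x
  have key := convex_univ.norm_image_sub_le_of_norm_hasDerivWithin_le (C := 6 * s ^ 2 * |u y|)
    (fun r _ => ((hasDerivAt_gibbsExp_update β s u x f r).sub
      (hasDerivAt_gibbsExp_update β s (Function.update u y 0) x f r)).hasDerivWithinAt)
    (fun r _ => ?_) (Set.mem_univ (0 : ℝ)) (Set.mem_univ (u x))
  · have hux : Function.update (Function.update u y 0) x (u x) = Function.update u y 0 := by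
      rw [Function.update_eq_self_iff, Function.update_of_ne hxy]
    simp only [Pi.sub_apply, Function.update_eq_self, hux, sub_zero, Real.norm_eq_abs] at key
    calc _ ≤ _ := key
      _ = _ := by ring
  · rw [hfx]
    set v := Function.update u x r with hv
    have hvy : v = Function.update v y (u y) := by
      rw [eq_comm, Function.update_eq_self_iff, hv, Function.update_of_ne hxy.symm]
    have hw : Function.update (Function.update u y 0) x r = Function.update v y 0 := by
      rw [hv, Function.update_comm hxy]
    rw [hw]
    have hx1 : ∀ σ : Config d n, |spin σ x| ≤ 1 := fun σ => (abs_spin σ x).le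
    have hy1 : ∀ σ : Config d n, |spin σ y| ≤ 1 := fun σ => (abs_spin σ y).le
    have l1 := abs_gibbsExp_update_sub_le β s v hy1 y (u y) 0
    have l2 := abs_gibbsExp_update_sub_le β s v hf y (u y) 0
    have l3 := abs_gibbsExp_update_sub_le β s v hx1 y (u y) 0
    rw [← hvy, sub_zero] at l1 l2 l3
    have b2 : |gibbsExp β s (Function.update v y 0) f| ≤ 1 := abs_gibbsExp_le_of_abs_le β s _ hf
    have b3 : |gibbsExp β s v (fun σ => spin σ x)| ≤ 1 := abs_gibbsExp_le_of_abs_le β s _ hx1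
    generalize gibbsExp β s v (fun σ => spin σ y) = a at *
    generalize gibbsExp β s v f = b at *
    generalize gibbsExp β s v (fun σ => spin σ x) = c at *
    generalize gibbsExp β s (Function.update v y 0) (fun σ => spin σ y) = a' at *
    generalize gibbsExp β s (Function.update v y 0) f = b' at *
    generalize gibbsExp β s (Function.update v y 0) (fun σ => spin σ x) = c' at *
    have e : s * (a - b * c) - s * (a' - b' * c')
        = s * ((a - a') - ((b - b') * c + b' * (c - c'))) := by ring
    rw [e, Real.norm_eq_abs, abs_mul]
    have hbc : |(b - b') * c| ≤ 2 * |s| * |u y| := by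
      rw [abs_mul]
      calc _ ≤ |b - b'| * 1 := mul_le_mul_of_nonneg_left b3 (abs_nonneg _)
        _ ≤ _ := by rwa [mul_one]
    have hcb : |b' * (c - c')| ≤ 2 * |s| * |u y| := by
      rw [abs_mul]
      calc _ ≤ 1 * |c - c'| := mul_le_mul_of_nonneg_right b2 (abs_nonneg _)
        _ ≤ _ := by rwa [one_mul]
    calc _ ≤ |s| * (6 * |s| * |u y|) := by
          refine mul_le_mul_of_nonneg_left ?_ (abs_nonneg s)
          have := abs_sub (a - a') ((b - b') * c + b' * (c - c'))
          have := abs_add_le ((b - b') * c) (b' * (c - c'))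
          linarith
      _ = 6 * (|s| * |s|) * |u y| := by ring
      _ = _ := by rw [abs_mul_abs_self]; ring

end Gibbs

/-! ### Second moment of the disorder energy -/

section SecondMoment

lemma card_box (d n : ℕ) : (box d n).card = n ^ d := by
  simp [box]

variable {Ω : Type*} [MeasurableSpace Ω] {P : Measure Ω} {d n : ℕ} {g : (Fin d → ℤ) → Ω → ℝ}

lemma aemeasurable_field (hg : ∀ x, AEMeasurable (g x) P) (n : ℕ) :
    AEMeasurable (field g n) P :=
  aemeasurable_pi_lambda _ fun x => hg x

/-- A centred disorder variable is orthogonal to every function of the disorder at the other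
sites. -/
lemma integral_mul_update_eq_zero (hindep : iIndepFun g P) (hg : ∀ x, AEMeasurable (g x) P)
    (hmean : ∀ x, ∫ ω, g x ω ∂P = 0) (x : box d n) {H : (box d n → ℝ) → ℝ}
    (hH : Measurable H) :
    ∫ ω, g x ω * H (Function.update (field g n ω) x 0) ∂P = 0 := by
  have hdisj : Disjoint {(x : Fin d → ℤ)} ((box d n).erase x) := by simp
  have hST := hindep.indepFun_finset₀ _ _ hdisj hg
  let φ : (({(x : Fin d → ℤ)} : Finset (Fin d → ℤ)) → ℝ) → ℝ :=
    fun v => v ⟨x, Finset.mem_singleton_self _⟩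
  let ψ : ((box d n).erase (x : Fin d → ℤ) → ℝ) → (box d n → ℝ) := fun v z =>
    if hz : z = x then 0
    else v ⟨z, Finset.mem_erase.2 ⟨fun hzx => hz (Subtype.ext hzx), z.2⟩⟩
  have hφ : Measurable φ := measurable_pi_apply _
  have hψ : Measurable ψ := by
    refine measurable_pi_lambda _ fun z => ?_
    by_cases hz : z = x
    · simp [ψ, hz]
    · simpa [ψ, hz] using measurable_pi_apply _
  have hupd : ∀ ω, Function.update (field g n ω) x 0
      = ψ (fun i : (box d n).erase (x : Fin d → ℤ) => g i ω) := by
    intro ω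
    funext z
    by_cases hz : z = x
    · subst hz; simp [ψ]
    · simp [ψ, hz, field]
  have hcomp : IndepFun (g x) (fun ω => H (Function.update (field g n ω) x 0)) P := by
    simp only [hupd]
    exact hST.comp hφ (hH.comp hψ)
  have hmeas : AEMeasurable (fun ω => H (Function.update (field g n ω) x 0)) P := by
    simp only [hupd]
    exact (hH.comp hψ).comp_aemeasurable (aemeasurable_pi_lambda _ fun i => hg i)
  rw [hcomp.integral_fun_mul_eq_mul_integral (hg x).aestronglyMeasurable
    hmeas.aestronglyMeasurable, hmean, zero_mul]

lemma integrable_mul_of_abs_le_one (hL2 : ∀ x, MemLp (g x) 2 P) (x y : box d n)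
    {H : (box d n → ℝ) → ℝ} (hH : Continuous H) (hH1 : ∀ u, |H u| ≤ 1) :
    Integrable (fun ω => g x ω * g y ω * H (field g n ω)) P := by
  have hg := aemeasurable_field (fun x => (hL2 x).aestronglyMeasurable.aemeasurable) n
  refine (MemLp.integrable_mul (hL2 x) (hL2 y)).mul_bdd (c := 1)
    (hH.measurable.comp_aemeasurable hg).aestronglyMeasurable (ae_of_all _ fun ω => hH1 _)

lemma integral_sq_eq_one (hL2 : ∀ x, MemLp (g x) 2 P) (hmean : ∀ x, ∫ ω, g x ω ∂P = 0)
    (hvar : ∀ x, variance (g x) P = 1) (x : Fin d → ℤ) : ∫ ω, g x ω ^ 2 ∂P = 1 := by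
  rw [← variance_of_integral_eq_zero (hL2 x).aestronglyMeasurable.aemeasurable (hmean x), hvar]

lemma gibbsExp_disorderEnergy_sq (β s : ℝ) (u : box d n → ℝ) :
    gibbsExp β s u (fun σ => disorderEnergy u σ ^ 2)
      = (((box d n).card : ℝ)⁻¹) ^ 2 * ∑ x, ∑ y,
          u x * u y * gibbsExp β s u (fun σ => spin σ x * spin σ y) := by
  have hsq : (fun σ : Config d n => disorderEnergy u σ ^ 2) = fun σ =>
      (((box d n).card : ℝ)⁻¹) ^ 2 * ∑ x, ∑ y, u x * u y * (spin σ x * spin σ y) := by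
    funext σ
    rw [disorderEnergy, mul_pow, sq (∑ x, u x * spin σ x), Finset.sum_mul_sum]
    congr 1
    exact Finset.sum_congr rfl fun x _ => Finset.sum_congr rfl fun y _ => by ring
  rw [hsq, gibbsExp_const_mul, gibbsExp_sum]
  simp only [gibbsExp_sum, gibbsExp_const_mul]

lemma integrable_gibbsExp_spin_mul_spin (hL2 : ∀ x, MemLp (g x) 2 P) (β s : ℝ) (x y : box d n) :
    Integrable (fun ω => g x ω * g y ω
      * gibbsExp β s (field g n ω) (fun σ => spin σ x * spin σ y)) P :=
  integrable_mul_of_abs_le_one hL2 x y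
    (H := fun u => gibbsExp β s u (fun σ => spin σ x * spin σ y))
    (continuous_gibbsExp β s (f := fun _ σ => spin σ x * spin σ y) fun _ => continuous_const)
    fun u => abs_gibbsExp_le_of_abs_le β s u fun σ => by
      rw [abs_mul, abs_spin, abs_spin, one_mul]

lemma integrable_gibbsExp_disorderEnergy_sq (hL2 : ∀ x, MemLp (g x) 2 P) (β s : ℝ) (n : ℕ) :
    Integrable (fun ω => gibbsExp β s (field g n ω)
      (fun σ => disorderEnergy (field g n ω) σ ^ 2)) P := by
  simp only [gibbsExp_disorderEnergy_sq]
  exact (integrable_finsetSum _ fun x _ => integrable_finsetSum _ fun y _ =>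
    integrable_gibbsExp_spin_mul_spin hL2 β s x y).const_mul _

/-- The correlations of `g_x g_y` with `⟨σ_x σ_y⟩` are of second order in the field strength.
Since the disorder variables at `x` and `y` are centred and independent of everything else,
`⟨σ_x σ_y⟩` may be replaced by its mixed second difference. -/
lemma abs_integral_mul_mul_gibbsExp_le (hindep : iIndepFun g P) (hL2 : ∀ x, MemLp (g x) 2 P)
    (hmean : ∀ x, ∫ ω, g x ω ∂P = 0) (hvar : ∀ x, variance (g x) P = 1) (β s : ℝ)
    {x y : box d n} (hxy : x ≠ y) :
    |∫ ω, g x ω * g y ω * gibbsExp β s (field g n ω) (fun σ => spin σ x * spin σ y) ∂P|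
      ≤ 6 * s ^ 2 := by
  set ψ : (box d n → ℝ) → ℝ := fun u => gibbsExp β s u (fun σ => spin σ x * spin σ y)
  have hψ : Continuous ψ := continuous_gibbsExp β s fun σ => continuous_const
  have hψ1 : ∀ u, |ψ u| ≤ 1 := fun u => abs_gibbsExp_le_of_abs_le β s u fun σ => by
    rw [abs_mul, abs_spin, abs_spin, one_mul]
  have hg : ∀ x, AEMeasurable (g x) P := fun x => (hL2 x).aestronglyMeasurable.aemeasurable
  have hcx : Continuous fun u : box d n → ℝ => Function.update u x 0 :=
    continuous_id.update x continuous_const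
  have hcy : Continuous fun u : box d n → ℝ => Function.update u y 0 :=
    continuous_id.update y continuous_const
  have i0 := integrable_mul_of_abs_le_one hL2 x y hψ hψ1
  have iy := integrable_mul_of_abs_le_one hL2 x y (hψ.comp hcy) fun u => hψ1 _
  have ix := integrable_mul_of_abs_le_one hL2 x y (hψ.comp hcx) fun u => hψ1 _
  have ixy := integrable_mul_of_abs_le_one hL2 x y (hψ.comp (hcx.comp hcy)) fun u => hψ1 _
  simp only [Function.comp_def] at iy ix ixy
  have zy : ∫ ω, g x ω * g y ω * ψ (Function.update (field g n ω) y 0) ∂P = 0 := by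
    refine Eq.trans (integral_congr_ae (ae_of_all _ fun ω => ?_))
      (integral_mul_update_eq_zero hindep hg hmean y
        (H := fun u => u x * ψ u) ((measurable_pi_apply x).mul hψ.measurable))
    simp only [Function.update_of_ne hxy, field]
    ring
  have zx : ∫ ω, g x ω * g y ω * ψ (Function.update (field g n ω) x 0) ∂P = 0 := by
    refine Eq.trans (integral_congr_ae (ae_of_all _ fun ω => ?_))
      (integral_mul_update_eq_zero hindep hg hmean x
        (H := fun u => u y * ψ u) ((measurable_pi_apply y).mul hψ.measurable))
    simp only [Function.update_of_ne hxy.symm, field]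
    ring
  have zxy : ∫ ω, g x ω * g y ω
      * ψ (Function.update (Function.update (field g n ω) y 0) x 0) ∂P = 0 := by
    refine Eq.trans (integral_congr_ae (ae_of_all _ fun ω => ?_))
      (integral_mul_update_eq_zero hindep hg hmean x
        (H := fun u => u y * ψ (Function.update u y 0))
        ((measurable_pi_apply y).mul (hψ.comp hcy).measurable))
    simp only [Function.update_of_ne hxy.symm, Function.update_comm hxy.symm, field]
    ring
  have heq : ∫ ω, g x ω * g y ω * ψ (field g n ω) ∂P
      = ∫ ω, g x ω * g y ω * ((ψ (field g n ω) - ψ (Function.update (field g n ω) y 0))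
          - (ψ (Function.update (field g n ω) x 0)
            - ψ (Function.update (Function.update (field g n ω) y 0) x 0))) ∂P := by
    simp only [mul_sub]
    have e := integral_sub (i0.sub iy) (ix.sub ixy)
    rw [integral_sub' i0 iy, integral_sub' ix ixy, zx, zy, zxy, sub_zero, sub_zero, sub_zero] at e
    exact e.symm
  have hne : (x : Fin d → ℤ) ≠ y := fun h => hxy (Subtype.ext h)
  have hind : IndepFun (fun ω => g x ω ^ 2) (fun ω => g y ω ^ 2) P :=
    (hindep.indepFun hne).comp (measurable_id.pow_const 2) (measurable_id.pow_const 2)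
  have hint : Integrable (fun ω => 6 * s ^ 2 * (g x ω ^ 2 * g y ω ^ 2)) P :=
    (hind.integrable_mul (hL2 x).integrable_sq (hL2 y).integrable_sq).const_mul _
  rw [heq, ← Real.norm_eq_abs]
  calc _ ≤ ∫ ω, 6 * s ^ 2 * (g x ω ^ 2 * g y ω ^ 2) ∂P := by
        refine norm_integral_le_of_norm_le hint (ae_of_all _ fun ω => ?_)
        have h := abs_gibbsExp_mixed_difference_le β s (field g n ω) hxy
        rw [Real.norm_eq_abs, abs_mul, abs_mul]
        calc _ ≤ |g x ω| * |g y ω| * (6 * s ^ 2 * |g x ω| * |g y ω|) :=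
              mul_le_mul_of_nonneg_left h (by positivity)
          _ = 6 * s ^ 2 * (|g x ω| ^ 2 * |g y ω| ^ 2) := by ring
          _ = _ := by rw [sq_abs, sq_abs]
    _ = 6 * s ^ 2 := by
        rw [integral_const_mul, hind.integral_fun_mul_eq_mul_integral
          (hL2 x).integrable_sq.aestronglyMeasurable (hL2 y).integrable_sq.aestronglyMeasurable,
          integral_sq_eq_one hL2 hmean hvar, integral_sq_eq_one hL2 hmean hvar]
        ring

lemma nu_disorderEnergy_sq_le (hindep : iIndepFun g P) (hL2 : ∀ x, MemLp (g x) 2 P)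
    (hmean : ∀ x, ∫ ω, g x ω ∂P = 0) (hvar : ∀ x, variance (g x) P = 1) (β s : ℝ) (n : ℕ) :
    nu P g n β s (fun u σ => disorderEnergy u σ ^ 2)
      ≤ ((box d n).card : ℝ)⁻¹ + 6 * s ^ 2 := by
  have hi := fun x y : box d n => integrable_gibbsExp_spin_mul_spin hL2 β s x y
  have hterm : ∀ x y : box d n,
      ∫ ω, g x ω * g y ω * gibbsExp β s (field g n ω) (fun σ => spin σ x * spin σ y) ∂P
        ≤ (if x = y then 1 else 0) + 6 * s ^ 2 := by
    intro x y
    by_cases hxy : x = y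
    · subst hxy
      simp only [spin_mul_self, gibbsExp_const, mul_one, if_true]
      simp only [← sq]
      rw [integral_sq_eq_one hL2 hmean hvar]
      linarith [sq_nonneg s]
    · rw [if_neg hxy, zero_add]
      exact (le_abs_self _).trans
        (abs_integral_mul_mul_gibbsExp_le hindep hL2 hmean hvar β s hxy)
  have hexp : ∀ ω, gibbsExp β s (field g n ω) (fun σ => disorderEnergy (field g n ω) σ ^ 2)
      = (((box d n).card : ℝ)⁻¹) ^ 2 * ∑ x : box d n, ∑ y : box d n, g x ω * g y ω
          * gibbsExp β s (field g n ω) (fun σ => spin σ x * spin σ y) :=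
    fun ω => gibbsExp_disorderEnergy_sq β s (field g n ω)
  simp only [nu, hexp]
  rw [integral_const_mul, integral_finsetSum _ fun x _ => integrable_finsetSum _ fun y _ => hi x y,
    Finset.sum_congr rfl fun x _ => integral_finsetSum _ fun y _ => hi x y]
  calc _ ≤ (((box d n).card : ℝ)⁻¹) ^ 2 * ∑ x : box d n, ∑ y : box d n,
          ((if x = y then 1 else 0) + 6 * s ^ 2) :=
        mul_le_mul_of_nonneg_left
          (Finset.sum_le_sum fun x _ => Finset.sum_le_sum fun y _ => hterm x y) (sq_nonneg _)
    _ = (((box d n).card : ℝ)⁻¹) ^ 2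
          * (((box d n).card : ℝ) + ((box d n).card : ℝ) ^ 2 * (6 * s ^ 2)) := by
        simp only [Finset.sum_add_distrib, Finset.sum_ite_eq, Finset.mem_univ, if_true,
          Finset.sum_const, Finset.card_univ, Fintype.card_coe, nsmul_eq_mul]
        ring
    -- an inequality only because of the empty box, for which `|V_n|⁻¹ = 0`
    _ ≤ _ := by
        rcases eq_or_ne ((box d n).card : ℝ) 0 with h0 | h0
        · rw [h0]; simp; positivity
        · apply le_of_eq
          field_simp

variable [IsProbabilityMeasure P]

/-- The mean absolute deviation is controlled by the second moment. -/
lemma nu_abs_disorderEnergy_sub_le (hL2 : ∀ x, MemLp (g x) 2 P) (β s : ℝ) (n : ℕ) {B : ℝ}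
    (hB : 0 < B) (hle : nu P g n β s (fun u σ => disorderEnergy u σ ^ 2) ≤ B) :
    nu P g n β s (fun u σ => |disorderEnergy u σ - nu P g n β s disorderEnergy|)
      ≤ 2 * Real.sqrt B := by
  have hg := aemeasurable_field (fun x => (hL2 x).aestronglyMeasurable.aemeasurable) n
  have hsq := integrable_gibbsExp_disorderEnergy_sq hL2 β s n
  set r := Real.sqrt B with hr
  have hr0 : 0 < r := Real.sqrt_pos.2 hB
  have hrB : r ^ 2 = B := Real.sq_sqrt hB.le
  -- Young's inequality `|Δ| ≤ r / 2 + Δ² / (2 r)`; the choice `r = √B` balances the two terms.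
  have hdom : ∀ u : box d n → ℝ, gibbsExp β s u (fun σ => |disorderEnergy u σ|)
      ≤ r / 2 + (2 * r)⁻¹ * gibbsExp β s u (fun σ => disorderEnergy u σ ^ 2) := by
    intro u
    rw [← gibbsExp_const_mul, ← gibbsExp_const β s u (r / 2), ← gibbsExp_add]
    refine gibbsExp_mono β s u fun σ => ?_
    rw [← sq_abs (disorderEnergy u σ)]
    have e : r / 2 + (2 * r)⁻¹ * |disorderEnergy u σ| ^ 2 - |disorderEnergy u σ|
        = (2 * r)⁻¹ * (|disorderEnergy u σ| - r) ^ 2 := by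
      field_simp
      ring
    have h3 : 0 ≤ (2 * r)⁻¹ * (|disorderEnergy u σ| - r) ^ 2 := by positivity
    linarith
  have hnn : ∀ u : box d n → ℝ, 0 ≤ gibbsExp β s u (fun σ => |disorderEnergy u σ|) := fun u => by
    rw [← gibbsExp_const β s u 0]
    exact gibbsExp_mono β s u fun σ => abs_nonneg _
  have hidom : Integrable (fun ω => r / 2 + (2 * r)⁻¹ * gibbsExp β s (field g n ω)
      (fun σ => disorderEnergy (field g n ω) σ ^ 2)) P :=
    (integrable_const _).add (hsq.const_mul _)
  have hcont : Continuous fun u : box d n → ℝ =>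
      gibbsExp β s u (fun σ => |disorderEnergy u σ|) := by
    refine continuous_gibbsExp β s fun σ => ?_
    unfold disorderEnergy
    fun_prop
  have hiabs : Integrable (fun ω => gibbsExp β s (field g n ω)
      (fun σ => |disorderEnergy (field g n ω) σ|)) P := by
    refine hidom.mono' (hcont.measurable.comp_aemeasurable hg).aestronglyMeasurable
      (ae_of_all _ fun ω => ?_)
    rw [Real.norm_eq_abs, abs_of_nonneg (hnn _)]
    exact hdom _
  have habs : nu P g n β s (fun u σ => |disorderEnergy u σ|) ≤ r := by
    have h1 : nu P g n β s (fun u σ => |disorderEnergy u σ|)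
        ≤ r / 2 + (2 * r)⁻¹ * nu P g n β s (fun u σ => disorderEnergy u σ ^ 2) := by
      refine (integral_mono hiabs hidom fun ω => hdom _).trans_eq ?_
      rw [integral_add (integrable_const _) (hsq.const_mul _), integral_const_mul]
      simp [nu]
    have h2 : (2 * r)⁻¹ * nu P g n β s (fun u σ => disorderEnergy u σ ^ 2) ≤ (2 * r)⁻¹ * B :=
      mul_le_mul_of_nonneg_left hle (by positivity)
    have h3 : (2 * r)⁻¹ * B = r / 2 := by
      rw [← hrB]
      field_simp
    linarith
  set c := nu P g n β s disorderEnergy with hc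
  have hcle : |c| ≤ r := by
    rw [hc, nu, ← Real.norm_eq_abs]
    refine le_trans (norm_integral_le_of_norm_le hiabs (ae_of_all _ fun ω => ?_)) habs
    refine abs_le.2 ⟨?_, gibbsExp_mono β s _ fun σ => le_abs_self _⟩
    rw [← neg_one_mul, ← gibbsExp_const_mul]
    refine gibbsExp_mono β s _ fun σ => ?_
    rw [neg_one_mul]
    exact neg_abs_le _
  calc _ ≤ ∫ ω, (gibbsExp β s (field g n ω)
          (fun σ => |disorderEnergy (field g n ω) σ|) + |c|) ∂P := by
        refine integral_mono_of_nonneg (ae_of_all _ fun ω => ?_)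
          (hiabs.add (integrable_const _)) (ae_of_all _ fun ω => ?_)
        · simp only [Pi.zero_apply]
          rw [← gibbsExp_const β s (field g n ω) 0]
          exact gibbsExp_mono β s _ fun σ => abs_nonneg _
        · simp only
          rw [← gibbsExp_const β s (field g n ω) |c|, ← gibbsExp_add]
          exact gibbsExp_mono β s _ fun σ => abs_sub (disorderEnergy (field g n ω) σ) c
    _ = nu P g n β s (fun u σ => |disorderEnergy u σ|) + |c| := by
        rw [integral_add hiabs (integrable_const _)]
        simp [nu]
    _ ≤ 2 * r := by linarith

/-- The disorder energy concentrates as soon as the field strength tends to zero. -/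
lemma tendsto_nu_abs_disorderEnergy_sub (hd : 1 ≤ d) (hindep : iIndepFun g P)
    (hL2 : ∀ x, MemLp (g x) 2 P) (hmean : ∀ x, ∫ ω, g x ω ∂P = 0)
    (hvar : ∀ x, variance (g x) P = 1) (β : ℝ) {s : ℕ → ℝ} (hs : Tendsto s atTop (𝓝 0)) :
    Tendsto (fun n => nu P g n β (s n)
      (fun u σ => |disorderEnergy u σ - nu P g n β (s n) disorderEnergy|)) atTop (𝓝 0) := by
  have hcard : Tendsto (fun n => ((box d n).card : ℝ)⁻¹) atTop (𝓝 0) := by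
    simp only [card_box]
    exact tendsto_inv_atTop_zero.comp
      (tendsto_natCast_atTop_atTop.comp (tendsto_pow_atTop (by omega)))
  have hlim : Tendsto (fun n => 2 * Real.sqrt (((box d n).card : ℝ)⁻¹ + 6 * s n ^ 2))
      atTop (𝓝 0) := by
    have h1 := (hcard.add ((hs.pow 2).const_mul 6)).sqrt.const_mul 2
    simpa using h1
  refine tendsto_of_tendsto_of_tendsto_of_le_of_le' tendsto_const_nhds hlim
    (Eventually.of_forall fun n => ?_) ?_
  · refine integral_nonneg fun ω => ?_
    simp only [Pi.zero_apply]
    rw [← gibbsExp_const β (s n) (field g n ω) 0]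
    exact gibbsExp_mono β (s n) _ fun σ => abs_nonneg _
  · filter_upwards [eventually_ge_atTop 1] with n hn
    have hpos : (0 : ℝ) < ((box d n).card : ℝ)⁻¹ := by
      rw [card_box]
      positivity
    exact nu_abs_disorderEnergy_sub_le hL2 β (s n) n (by positivity)
      (nu_disorderEnergy_sq_le hindep hL2 hmean hvar β (s n) n)

end SecondMoment

end RFIM

/-! ### Convex functions of one real variable -/

/-- The left and the right derivative of a convex function agree wherever the right derivative,
which is monotone, is continuous. -/
lemma ConvexOn.countable_leftDeriv_ne_rightDeriv {f : ℝ → ℝ} (hf : ConvexOn ℝ Set.univ f) :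
    {x | derivWithin f (Set.Iio x) x ≠ derivWithin f (Set.Ioi x) x}.Countable := by
  have hmono : Monotone fun x => derivWithin f (Set.Ioi x) x := by
    have h := hf.monotoneOn_rightDeriv
    rw [interior_univ] at h
    exact monotoneOn_univ.1 h
  refine hmono.countable_not_continuousAt.mono fun x hx => ?_
  intro hcont
  refine hx ?_
  refine le_antisymm (hf.leftDeriv_le_rightDeriv_of_mem_interior (by simp)) ?_
  have ht : Tendsto (fun y => derivWithin f (Set.Ioi y) y) (𝓝[<] x)
      (𝓝 (derivWithin f (Set.Ioi x) x)) := hcont.tendsto.mono_left nhdsWithin_le_nhds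
  refine le_of_tendsto ht ?_
  filter_upwards [self_mem_nhdsWithin] with y (hy : y < x)
  exact (hf.rightDeriv_le_slope_of_mem_interior (by simp) (Set.mem_univ x) hy).trans
    (hf.slope_le_leftDeriv_of_mem_interior (Set.mem_univ y) (by simp) hy)

/-- A logarithm of a sum of exponentials of affine functions is convex: the tangent at any point
lies below the graph, by `1 + r ≤ exp r`. -/
lemma convexOn_log_sum_exp_affine {ι : Type*} [Fintype ι] [Nonempty ι] (c a : ι → ℝ) :
    ConvexOn ℝ Set.univ fun t => Real.log (∑ i, Real.exp (c i + t * a i)) := by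
  have hpos : ∀ t, 0 < ∑ i, Real.exp (c i + t * a i) := fun t =>
    Finset.sum_pos (fun _ _ => Real.exp_pos _) Finset.univ_nonempty
  have tangent : ∀ z, ∃ k, ∀ t, Real.log (∑ i, Real.exp (c i + z * a i)) + (t - z) * k
      ≤ Real.log (∑ i, Real.exp (c i + t * a i)) := by
    intro z
    set S := ∑ i, Real.exp (c i + z * a i) with hS
    have hSpos : 0 < S := hpos z
    refine ⟨(∑ i, a i * Real.exp (c i + z * a i)) / S, fun t => ?_⟩
    set k := (∑ i, a i * Real.exp (c i + z * a i)) / S with hk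
    rw [Real.le_log_iff_exp_le (hpos t), Real.exp_add, Real.exp_log hSpos]
    have hkS : ∑ i, a i * Real.exp (c i + z * a i) = k * S := by
      rw [hk, div_mul_cancel₀ _ hSpos.ne']
    calc S * Real.exp ((t - z) * k)
        = Real.exp ((t - z) * k)
            * ∑ i, Real.exp (c i + z * a i) * ((t - z) * (a i - k) + 1) := by
          have : ∑ i, Real.exp (c i + z * a i) * ((t - z) * (a i - k) + 1)
              = (t - z) * (∑ i, a i * Real.exp (c i + z * a i)) - (t - z) * k * S + S := by
            rw [hS, Finset.mul_sum, Finset.mul_sum, ← Finset.sum_sub_distrib,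
              ← Finset.sum_add_distrib]
            exact Finset.sum_congr rfl fun i _ => by ring
          rw [this, hkS]
          ring
      _ ≤ Real.exp ((t - z) * k)
            * ∑ i, Real.exp (c i + z * a i) * Real.exp ((t - z) * (a i - k)) := by
          gcongr with i
          exact Real.add_one_le_exp _
      _ = ∑ i, Real.exp (c i + t * a i) := by
          rw [Finset.mul_sum]
          refine Finset.sum_congr rfl fun i _ => ?_
          rw [← Real.exp_add, ← Real.exp_add]
          congr 1
          ring
  refine ⟨convex_univ, fun x _ y _ p q hp hq hpq => ?_⟩
  obtain ⟨k, hk⟩ := tangent (p • x + q • y)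
  have hx := mul_le_mul_of_nonneg_left (hk x) hp
  have hy := mul_le_mul_of_nonneg_left (hk y) hq
  simp only [smul_eq_mul] at *
  generalize Real.log (∑ i, Real.exp (c i + (p * x + q * y) * a i)) = L at *
  have e : p * (L + (x - (p * x + q * y)) * k) + q * (L + (y - (p * x + q * y)) * k)
      = L := by
    obtain rfl : q = 1 - p := by linarith
    ring
  linarith

/-- The pointwise upper limit of a pointwise bounded sequence of convex functions is convex. -/
lemma convexOn_limsup {F : ℕ → ℝ → ℝ} (hF : ∀ n, ConvexOn ℝ Set.univ (F n))
    (hbd : ∀ x, ∃ C, ∀ n, |F n x| ≤ C) :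
    ConvexOn ℝ Set.univ fun x => limsup (fun n => F n x) atTop := by
  have hle : ∀ x, IsBoundedUnder (· ≤ ·) atTop fun n => F n x := fun x => by
    obtain ⟨C, hC⟩ := hbd x
    exact isBoundedUnder_of ⟨C, fun n => (abs_le.1 (hC n)).2⟩
  have hge : ∀ x, IsBoundedUnder (· ≥ ·) atTop fun n => F n x := fun x => by
    obtain ⟨C, hC⟩ := hbd x
    exact isBoundedUnder_of ⟨-C, fun n => (abs_le.1 (hC n)).1⟩
  refine ⟨convex_univ, fun x _ y _ p q hp hq hpq => ?_⟩
  simp only [smul_eq_mul]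
  refine le_of_forall_pos_le_add fun ε hε => ?_
  refine limsup_le_of_le (hge _).isCoboundedUnder_le ?_
  filter_upwards [eventually_lt_of_limsup_lt (lt_add_of_pos_right _ hε) (hle x),
    eventually_lt_of_limsup_lt (lt_add_of_pos_right _ hε) (hle y)] with n hx hy
  have h := (hF n).2 (Set.mem_univ x) (Set.mem_univ y) hp hq hpq
  simp only [smul_eq_mul] at h
  have h1 := mul_le_mul_of_nonneg_left hx.le hp
  have h2 := mul_le_mul_of_nonneg_left hy.le hq
  have e : p * ε + q * ε = ε := by rw [← add_mul, hpq, one_mul]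
  linarith

namespace RFIM

/-! ### Convexity of the limiting free energy -/

section FreeEnergy

variable {d n : ℕ}

/-- A site has at most `3 ^ d` nearest neighbours, because they differ from it by at most one in
each coordinate. -/
lemma card_neighborPairs_le (d n : ℕ) :
    (neighborPairs d n).card ≤ (box d n).card * 3 ^ d := by
  classical
  have hsub : (neighborPairs d n).card ≤ ((Finset.univ : Finset (box d n)) ×ˢ
      Fintype.piFinset fun _ : Fin d => Finset.Icc (-1 : ℤ) 1).card := by
    refine Finset.card_le_card_of_injOn (fun e => (e.1, fun i => e.2.1 i - e.1.1 i)) ?_ ?_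
    · rintro ⟨x, y⟩ he
      have he' : ∑ i, |x.1 i - y.1 i| = 1 :=
        (Finset.mem_filter.1 (Finset.mem_coe.1 he)).2
      simp only [Finset.coe_product, Set.mem_prod, Finset.mem_coe, Finset.mem_univ, true_and,
        Fintype.mem_piFinset, Finset.mem_Icc]
      intro i
      have hi : |x.1 i - y.1 i| ≤ 1 := he' ▸
        Finset.single_le_sum (f := fun i => |x.1 i - y.1 i|) (fun i _ => abs_nonneg _)
          (Finset.mem_univ i)
      have := abs_le.1 hi
      constructor <;> linarith [this.1, this.2]
    · rintro ⟨x, y⟩ - ⟨x', y'⟩ - hee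
      simp only [Prod.mk.injEq] at hee
      obtain ⟨rfl, h2⟩ := hee
      have : y = y' := Subtype.ext <| funext fun i => by
        have := congrFun h2 i
        simpa using this
      rw [this]
  simpa [Finset.card_product, Fintype.card_piFinset_const] using hsub

lemma abs_energy_le (b s : ℝ) (u : box d n → ℝ) (σ : Config d n) :
    |energy b s u σ| ≤ |b| * ((box d n).card * 3 ^ d) + |s| * ∑ x, |u x| := by
  have h1 : |∑ e ∈ neighborPairs d n, spin σ e.1 * spin σ e.2| ≤ (box d n).card * 3 ^ d := by
    refine (Finset.abs_sum_le_sum_abs _ _).trans ?_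
    simp only [abs_mul, abs_spin, mul_one, Finset.sum_const, nsmul_eq_mul]
    exact_mod_cast card_neighborPairs_le d n
  have h2 : |∑ x, u x * spin σ x| ≤ ∑ x, |u x| := by
    refine (Finset.abs_sum_le_sum_abs _ _).trans_eq ?_
    simp only [abs_mul, abs_spin, mul_one]
  rw [energy]
  refine (abs_add_le _ _).trans ?_
  rw [abs_mul, abs_mul]
  exact add_le_add (mul_le_mul_of_nonneg_left h1 (abs_nonneg _))
    (mul_le_mul_of_nonneg_left h2 (abs_nonneg _))

lemma abs_log_partitionFn_le (b s : ℝ) (u : box d n → ℝ) :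
    |Real.log (partitionFn b s u)|
      ≤ (box d n).card * (Real.log 2 + |b| * 3 ^ d) + |s| * ∑ x, |u x| := by
  set M := |b| * ((box d n).card * 3 ^ d) + |s| * ∑ x, |u x| with hM
  have hE := fun σ => abs_le.1 (abs_energy_le b s u σ)
  have hcard : (Fintype.card (Config d n) : ℝ) = 2 ^ (box d n).card := by
    simp [Fintype.card_pi]
  have hup : partitionFn b s u ≤ 2 ^ (box d n).card * Real.exp M := by
    rw [← hcard, ← nsmul_eq_mul, ← Finset.card_univ]
    exact Finset.sum_le_card_nsmul _ _ _ fun σ _ => Real.exp_le_exp.2 (hE σ).2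
  have hlow : Real.exp (-M) ≤ partitionFn b s u := by
    let σ₀ : Config d n := fun _ => 1
    exact (Real.exp_le_exp.2 (hE σ₀).1).trans
      (Finset.single_le_sum (f := fun σ => Real.exp (energy b s u σ))
        (fun _ _ => (Real.exp_pos _).le) (Finset.mem_univ σ₀))
  have l1 : Real.log (partitionFn b s u) ≤ (box d n).card * Real.log 2 + M := by
    refine (Real.log_le_log (partitionFn_pos b s u) hup).trans_eq ?_
    rw [Real.log_mul (by positivity) (Real.exp_pos _).ne', Real.log_pow, Real.log_exp]
  have l2 : -M ≤ Real.log (partitionFn b s u) :=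
    (Real.le_log_iff_exp_le (partitionFn_pos b s u)).2 hlow
  have l3 : 0 ≤ ((box d n).card : ℝ) * Real.log 2 := by positivity
  have e : (box d n).card * (Real.log 2 + |b| * 3 ^ d) + |s| * ∑ x, |u x|
      = (box d n).card * Real.log 2 + M := by rw [hM]; ring
  rw [e, abs_le]
  constructor <;> linarith

lemma convexOn_log_partitionFn (b : ℝ) (u : box d n → ℝ) :
    ConvexOn ℝ Set.univ fun s => Real.log (partitionFn b s u) :=
  convexOn_log_sum_exp_affine (fun σ : Config d n =>
    b * (∑ e ∈ neighborPairs d n, spin σ e.1 * spin σ e.2)) fun σ => ∑ x, u x * spin σ x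

variable {Ω : Type*} [MeasurableSpace Ω] {P : Measure Ω} [IsProbabilityMeasure P]
  {g : (Fin d → ℤ) → Ω → ℝ}

lemma integrable_log_partitionFn (hint : ∀ x, Integrable (g x) P) (b s : ℝ) (n : ℕ) :
    Integrable (fun ω => Real.log (partitionFn b s (field g n ω))) P := by
  have hsum : Integrable (fun ω => ∑ x : box d n, |field g n ω x|) P :=
    integrable_finsetSum _ fun x _ => (hint x).abs
  have hdom : Integrable (fun ω => (box d n).card * (Real.log 2 + |b| * 3 ^ d)
      + |s| * ∑ x : box d n, |field g n ω x|) P :=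
    (integrable_const _).add (hsum.const_mul _)
  have hcont : Continuous fun u : box d n → ℝ => Real.log (partitionFn b s u) :=
    (continuous_partitionFn b s).log fun u => (partitionFn_pos b s u).ne'
  have hmeas : AEMeasurable (fun ω => Real.log (partitionFn b s (field g n ω))) P :=
    hcont.measurable.comp_aemeasurable
      (aemeasurable_field (fun x => (hint x).aestronglyMeasurable.aemeasurable) n)
  exact hdom.mono' hmeas.aestronglyMeasurable
    (ae_of_all _ fun ω => abs_log_partitionFn_le b s (field g n ω))

lemma convexOn_freeEnergy (hint : ∀ x, Integrable (g x) P) (h : ℕ → ℝ) (n : ℕ) (b : ℝ) :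
    ConvexOn ℝ Set.univ (freeEnergy P g h n b) := by
  refine ⟨convex_univ, fun x _ y _ p q hp hq hpq => ?_⟩
  have hi := fun m => (integrable_log_partitionFn hint b (m - h n) n).div_const
    ((box d n).card : ℝ)
  simp only [freeEnergy, smul_eq_mul]
  rw [← integral_const_mul, ← integral_const_mul,
    ← integral_add ((hi x).const_mul p) ((hi y).const_mul q)]
  refine integral_mono (hi _) (((hi x).const_mul p).add ((hi y).const_mul q)) fun ω => ?_
  have hc := (convexOn_log_partitionFn b (field g n ω)).2 (Set.mem_univ (x - h n))
    (Set.mem_univ (y - h n)) hp hq hpq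
  have e : p * x + q * y - h n = p • (x - h n) + q • (y - h n) := by
    simp only [smul_eq_mul]
    linear_combination h n * hpq
  simp only [e]
  refine (div_le_div_of_nonneg_right hc (Nat.cast_nonneg _)).trans_eq ?_
  simp only [smul_eq_mul]
  ring

lemma abs_freeEnergy_le (hint : ∀ x, Integrable (g x) P) (habs : ∀ x, ∫ ω, |g x ω| ∂P ≤ 1)
    (h : ℕ → ℝ) (n : ℕ) (b m : ℝ) :
    |freeEnergy P g h n b m| ≤ Real.log 2 + |b| * 3 ^ d + |m - h n| := by
  have hpos : 0 ≤ Real.log 2 + |b| * 3 ^ d + |m - h n| := by positivity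
  rw [freeEnergy, integral_div, abs_div, Nat.abs_cast]
  refine div_le_of_le_mul₀ (Nat.cast_nonneg _) hpos ?_
  have hsum : Integrable (fun ω => ∑ x : box d n, |field g n ω x|) P :=
    integrable_finsetSum _ fun x _ => (hint x).abs
  have hswap : ∫ ω, ∑ x : box d n, |field g n ω x| ∂P = ∑ x : box d n, ∫ ω, |g x ω| ∂P :=
    integral_finsetSum _ fun x _ => (hint x).abs
  rw [← Real.norm_eq_abs]
  calc _ ≤ ∫ ω, ((box d n).card * (Real.log 2 + |b| * 3 ^ d)
          + |m - h n| * ∑ x : box d n, |field g n ω x|) ∂P :=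
        norm_integral_le_of_norm_le ((integrable_const _).add (hsum.const_mul _))
          (ae_of_all _ fun ω => abs_log_partitionFn_le b (m - h n) _)
    _ = (box d n).card * (Real.log 2 + |b| * 3 ^ d)
          + |m - h n| * ∑ x : box d n, ∫ ω, |g x ω| ∂P := by
        rw [integral_add (integrable_const _) (hsum.const_mul _), integral_const,
          probReal_univ, one_smul, integral_const_mul, hswap]
    _ ≤ (box d n).card * (Real.log 2 + |b| * 3 ^ d) + |m - h n| * (box d n).card := by
        gcongr
        calc _ ≤ ∑ _x : box d n, (1 : ℝ) := Finset.sum_le_sum fun x _ => habs x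
          _ = _ := by simp
    _ = _ := by ring

/-- For bounded `h`, the limiting free energy is finite and convex in the field strength. -/
lemma convexOn_limitFreeEnergy (hint : ∀ x, Integrable (g x) P)
    (habs : ∀ x, ∫ ω, |g x ω| ∂P ≤ 1) {h : ℕ → ℝ} {C : ℝ} (hC : ∀ n, |h n| ≤ C) (b : ℝ) :
    ConvexOn ℝ Set.univ (limitFreeEnergy P g h b) := by
  refine convexOn_limsup (fun n => convexOn_freeEnergy hint h n b) fun m =>
    ⟨Real.log 2 + |b| * 3 ^ d + (|m| + C), fun n => ?_⟩
  have h1 := abs_freeEnergy_le hint habs h n b m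
  have h2 := abs_sub m (h n)
  linarith [hC n]

lemma countable_singularSet_section (hint : ∀ x, Integrable (g x) P)
    (habs : ∀ x, ∫ ω, |g x ω| ∂P ≤ 1) {h : ℕ → ℝ} {C : ℝ} (hC : ∀ n, |h n| ≤ C) (b : ℝ) :
    {m : ℝ | (b, m) ∈ singularSet P g h}.Countable :=
  (convexOn_limitFreeEnergy hint habs hC b).countable_leftDeriv_ne_rightDeriv.mono
    fun _ hm => hm.2.2

end FreeEnergy

end RFIM

theorem mainTheorem4 {Ω : Type*} [MeasurableSpace Ω] (P : Measure Ω) [IsProbabilityMeasure P]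
    (d : ℕ) (hd : 1 ≤ d)
    -- the disorder: independent, zero mean, unit variance
    (g : (Fin d → ℤ) → Ω → ℝ) (hindep : iIndepFun g P)
    (hL2 : ∀ x, MemLp (g x) 2 P) (hmean : ∀ x, ∫ ω, g x ω ∂P = 0)
    (hvar : ∀ x, variance (g x) P = 1)
    -- the parameters, and the conditions on the field strength `μ - h n`
    (β μ : ℝ) (hβ : 0 < β) (hμ : 0 < μ) (h : ℕ → ℝ) (hpos : ∀ n, 1 ≤ n → 0 < μ - h n)
    (hlim : Tendsto h atTop (𝓝 μ))
    (hrate : Tendsto (fun n => (μ - h n) * Real.sqrt ((RFIM.box d n).card : ℝ)) atTop atTop)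
    (htail : ∀ ε : ℝ, 0 < ε →
      Tendsto (fun n => RFIM.thirdMomentTail P g n (ε * (μ - h n)⁻¹)) atTop (𝓝 0)) :
    (∀ b : ℝ, {m : ℝ | (b, m) ∈ RFIM.singularSet P g h}.Countable) ∧
    ((β, μ) ∉ RFIM.singularSet P g h →
      Tendsto
        (fun n => RFIM.nu P g n β (μ - h n) (fun u σ =>
          |RFIM.disorderEnergy u σ - RFIM.nu P g n β (μ - h n) RFIM.disorderEnergy|))
        atTop (𝓝 0)) := by
  refine ⟨fun b => ?_, fun _ => ?_⟩
  · obtain ⟨C, hC⟩ := (hlim.abs).bddAbove_range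
    refine RFIM.countable_singularSet_section (fun x => (hL2 x).integrable one_le_two)
      (fun x => ?_) (fun n => hC ⟨n, rfl⟩) b
    -- `𝔼|g_x| ≤ (1 + 𝔼 g_x²) / 2 = 1`
    have hi := (hL2 x).integrable one_le_two
    have hmono : ∫ ω, |g x ω| ∂P ≤ ∫ ω, (1 / 2 + 1 / 2 * g x ω ^ 2) ∂P := by
      refine integral_mono hi.abs ((integrable_const _).add
        ((hL2 x).integrable_sq.const_mul _)) fun ω => ?_
      simp only
      nlinarith [sq_nonneg (|g x ω| - 1), sq_abs (g x ω)]
    refine hmono.trans_eq ?_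
    rw [integral_add (integrable_const _) ((hL2 x).integrable_sq.const_mul _),
      integral_const_mul, RFIM.integral_sq_eq_one hL2 hmean hvar]
    norm_num
  · have hs : Tendsto (fun n => μ - h n) atTop (𝓝 0) := by
      simpa using hlim.const_sub μ
    exact RFIM.tendsto_nu_abs_disorderEnergy_sub hd hindep hL2 hmean hvar β hs
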